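/- **Setting.** Fix finite sets of statements, of identifiers of non-deterministic branches, and of identifiers of fair probabilistic choices. The finite label set $\Sigma$ consists of the statements, the labels $*_j$, and labels $\mathtt{Pb}_{(i,L)},\mathtt{Pb}_{(i,R)}$ for every probabilistic choice $i$. An *action* is a non-probabilistic label or an identifier $i$. A statement is interpreted as a partial function on program states (undefined when an $\mathtt{assume}$ blocks); the other labels act as $skip$; $[\![\tau]\!]$ is the composite partial function of a trace $\tau\in\Sigma^*$, and $wt(\tau)=2^{-n}$, where $n$ is the number of probabilistic labels in $\tau$; $wt(\Theta)=\sum_{\tau\in\Theta}wt(\tau)$. A control-flow automaton (CFA) has finitely many locations, a transition relation labelled by $\Sigma$, an initial and an ending location, and $\mathcal L$ denotes its set of accepting traces. A *CFMDP* is a deterministic CFA with no edge out of the ending location; a *CFMC* is a CFMDP with at most one action at each location. A set of traces is *mergeable* if it is $\mathcal L(\mathcal M)$ for some CFMC $\mathcal M$. Programs $P$ are identified with their CFAs, which are CFMDPs. A finite-memory strategy $\psi$ has a finite memory and a partial function mapping a location and a memory state to an action and a next memory state; $P^\psi$ is the CFMC it induces. A specification is a pair of propositions $(\varphi_e,\varphi_f)$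 on states. Put $$\mathbb P(P)=\sup_{s\models\varphi_e}\ \sup_{\psi}\ \sum_{\tau\in\mathcal L(P^\psi)}wt(\tau)\,[\,[\![\tau]\!](s)\text{ is defined and }\models\neg\varphi_f\,].$$ For $\beta\ge 0$, $P$ satisfies $\vdash_\beta\{\varphi_e\}P\{\varphi_f\}$ if $\mathbb P(P)\le\beta$. Let $wp(\tau,\neg\varphi_f)$ be the set of states from which $\tau$ is executable and ends in a state violating $\varphi_f$. A trace $\tau$ is *violating* if $\varphi_e\wedge wp(\tau,\neg\varphi_f)$ is satisfiable. For a set $\Theta$ of traces, the MDP upper bound $U(\Theta)$ is the supremum of $wt(\Xi)$ over mergeable $\Xi\subseteq\Theta$. A *counterexample* is a pair $(S,\varphi_{err})$ with $S\subseteq\mathcal L(P)$, any two distinct traces of $S$ agreeing up to a point where they take the two different branches $\mathtt{Pb}_{(i,L)}$, $\mathtt{Pb}_{(i,R)}$ of one probabilistic choice, $\varphi_{err}$ satisfiable, $\varphi_{err}\to\varphi_e$, $[\![\tau]\!](s)\models\neg\varphi_f$ for all $s\models\varphi_{err}$ and $\tau\in S$, and $wt(S)>\beta$. **The modified algorithm.**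 It maintains a certified module $Q$ (a finite union of CFAs) and a repository $A$ (a set of traces), both initially empty. Let $R=\mathcal L(P)\setminus(\mathcal L(Q)\cup A)$. *Main loop.* If $U(R\cup A)\le\beta$, or if $R=\emptyset$, it may answer SAT. If $U(R\cup A)>\beta$ and $R\neq\emptyset$, it may pick some $\tau\in R$ of minimal length. (1) If $\tau$ is not violating, some CFA that accepts $\tau$ and accepts only non-violating traces is added to $Q$. (2) If $\tau$ is violating and $wt(\tau)>\beta$, it returns $(\{\tau\},\varphi_e\wedge wp(\tau,\neg\varphi_f))$. (3) If $\tau$ is violating and $wt(\tau)\le\beta$, then $\tau$ is added to $A$ without generalisation, and $A$ is examined. *Examination.* It works on a finite collection of cells $(G,T)$, where $G$ is a split condition and $T$ a set of traces, initially the single cell $(\mathtt{True},A)$. If the maximum $p$ of $U(T)$ over all cells is $\le\beta$, the examination ends and the main loop resumes with $Q$ and $A$ unchanged. Otherwise a cell $(G,T)$ and a mergeable $M\subseteq T$ with $wt(M)=p$ are chosen. The traces of $M$ are verified one by one in order of decreasing weight. With $S$ the current *mainstream* set (initially empty), let $H=\varphi_e\wedge G\wedge\bigwedge_{\sigma\in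 S}wp(\sigma,\neg\varphi_f)$ be its total precondition. A trace $\tau$ is *fake* (recorded in $F$) if $\varphi_e\wedge G\wedge wp(\tau,\neg\varphi_f)$ is unsatisfiable, it is added to $S$ if $H\wedge wp(\tau,\neg\varphi_f)$ is satisfiable, and it is *incompatible* (recorded in $J$) otherwise. Verification stops as soon as $wt(S)>\beta$, when the algorithm returns $(S,H)$, or $wt(F\cup J)\ge p-\beta$. In the latter case let $E\supseteq F$ be any set of traces that are fake under $G$ (a generalisation of $F$). If $J=\emptyset$, the cell is replaced by $(G,T\setminus E)$. If $J\ne\emptyset$, it is replaced by the two cells $(H,\,T\setminus(E\cup J))$ and $(G\wedge\neg H,\,T\setminus(E\cup S'))$, where $S'$ is the set of traces in $S$ that are fake under $G\wedge\neg H$. The examination is then repeated. All choices left open (among the shortest traces, of the generalising automata and sets, of $M$, among traces of equal weight) are arbitrary. **Theorem.** Let $P$ be a program, $(\varphi_e,\varphi_f)$ a specification and $\beta\ge 0$ a threshold. If $P$ does not satisfy $\vdash_\beta\{\varphi_e\}P\{\varphi_f\}$, then the modified algorithm eventually terminates and produces a counterexample: whatever choices it makes, it has no infinite run, and every run that cannot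 be continued has stopped by returning a pair $(S,\varphi_{err})$, with $S$ finite, that is a counterexample of $P$ for $(\varphi_e,\varphi_f)$ with threshold $\beta$. -/

import Mathlib

open scoped ENNReal NNReal

namespace ProbTA

section Syntax_and_semantics

/-- Labels: the non-random statements `B` of the program (assignments, `skip`, `assume b`, ...),
the labels `*_j` of the branches of non-deterministic choices, and the labels `Pb_(i,L)`,
`Pb_(i,R)` (`d = false`, `d = true`) of the two branches of the fair probabilistic choice `i`. -/
inductive Label (B N I : Type*) where
  | stmt (b : B)
  | nondet (j : N)
  | prob (i : I) (d : Bool)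

/-- Actions: identifiers of probabilistic choices, and the non-random labels. -/
inductive Action (B N I : Type*) where
  | stmt (b : B)
  | nondet (j : N)
  | prob (i : I)

variable {B N I State : Type*}

/-- The action that a label belongs to. -/
def Label.action : Label B N I → Action B N I
  | .stmt b => .stmt b
  | .nondet j => .nondet j
  | .prob i _ => .prob i

/-- Is the label probabilistic? -/
def Label.isProb : Label B N I → Bool
  | .prob _ _ => true
  | _ => false

/-- A trace is a finite word of labels. -/
abbrev Trace (B N I : Type*) := List (Label B N I)

/-- Interpretation of a label. A statement is interpreted by a partial function of program states
(`none`: the execution is blocked, as for `assume b` in a state where `b` fails);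
random labels act as `skip`. -/
def Label.interp (sem : B → State → Option State) : Label B N I → State → Option State
  | .stmt b, s => sem b s
  | .nondet _, s => some s
  | .prob _ _, s => some s

/-- Interpretation of a trace. -/
def interp (sem : B → State → Option State) : Trace B N I → State → Option State
  | [], s => some s
  | σ :: τ, s => (σ.interp sem s).bind (interp sem τ)

/-- `wp sem τ X`: the states from which `τ` is executable and leads to a state in `X`. -/
def wp (sem : B → State → Option State) (τ : Trace B N I) (X : Set State) : Set State :=
  {s | ∃ s', interp sem τ s = some s' ∧ s' ∈ X}

/-- The weight `2^(-n)` of a trace with `n` probabilistic labels. -/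
noncomputable def wt (τ : Trace B N I) : ℝ≥0∞ := (2⁻¹ : ℝ≥0∞) ^ τ.countP Label.isProb

/-- Total weight of a set of traces. -/
noncomputable def weight (Θ : Set (Trace B N I)) : ℝ≥0∞ := ∑' τ : Θ, wt (τ : Trace B N I)

end Syntax_and_semantics

/-- A (probabilistic) control-flow automaton over a label set `Λ`. -/
structure PCFA (Λ : Type*) where
  Loc : Type
  finite_loc : Finite Loc
  δ : Loc → Λ → Loc → Prop
  start : Loc
  final : Loc

/-- `𝒜.Path ℓ τ ℓ'`: the word `τ` labels a path from `ℓ` to `ℓ'`. -/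
def PCFA.Path {Λ : Type*} (𝒜 : PCFA Λ) : 𝒜.Loc → List Λ → 𝒜.Loc → Prop
  | ℓ, [], ℓ' => ℓ = ℓ'
  | ℓ, σ :: τ, ℓ' => ∃ m, 𝒜.δ ℓ σ m ∧ 𝒜.Path m τ ℓ'

/-- The set of accepting traces. -/
def PCFA.language {Λ : Type*} (𝒜 : PCFA Λ) : Set (List Λ) :=
  {τ | 𝒜.Path 𝒜.start τ 𝒜.final}

/-- A CFMDP: a deterministic automaton without edges out of the ending location. -/
structure PCFA.IsCFMDP {Λ : Type*} (𝒜 : PCFA Λ) : Prop where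
  deterministic : ∀ ℓ σ ℓ₁ ℓ₂, 𝒜.δ ℓ σ ℓ₁ → 𝒜.δ ℓ σ ℓ₂ → ℓ₁ = ℓ₂
  no_out : ∀ σ ℓ, ¬ 𝒜.δ 𝒜.final σ ℓ

section Models

variable {B N I State : Type*}

/-- A CFMC: a CFMDP with at most one action at every location. -/
structure PCFA.IsCFMC (𝒜 : PCFA (Label B N I)) : Prop extends 𝒜.IsCFMDP where
  one_action : ∀ ℓ σ₁ σ₂ ℓ₁ ℓ₂, 𝒜.δ ℓ σ₁ ℓ₁ → 𝒜.δ ℓ σ₂ ℓ₂ → σ₁.action = σ₂.action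

/-- A finite-memory strategy for an automaton: `next` is a partial function. -/
structure Strategy (𝒜 : PCFA (Label B N I)) where
  Mem : Type
  finite_mem : Finite Mem
  next : 𝒜.Loc → Mem → Option (Action B N I × Mem)
  start : Mem

/-- `(ℓ, q)` lies in the domain of the strategy. -/
def Strategy.Dom {𝒜 : PCFA (Label B N I)} (ψ : Strategy 𝒜) (ℓ : 𝒜.Loc) (q : ψ.Mem) : Prop :=
  ∃ a, ψ.next ℓ q = some a

open Classical in
/-- Locations of the induced model are `some (ℓ, q)` and the new ending location `none`,
which replaces all `(ℓ, q)` where `ℓ` is the ending location of `𝒜`. -/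
noncomputable def Strategy.target {𝒜 : PCFA (Label B N I)} (ψ : Strategy 𝒜)
    (ℓ : 𝒜.Loc) (q : ψ.Mem) : Option (𝒜.Loc × ψ.Mem) :=
  if ℓ = 𝒜.final then none else some (ℓ, q)

/-- Transitions of the model induced by a strategy. -/
inductive Strategy.Trans {𝒜 : PCFA (Label B N I)} (ψ : Strategy 𝒜) :
    Option (𝒜.Loc × ψ.Mem) → Label B N I → Option (𝒜.Loc × ψ.Mem) → Prop
  | nonrandom {ℓ ℓ' : 𝒜.Loc} {q q' : ψ.Mem} {σ : Label B N I} :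
      σ.isProb = false → ψ.next ℓ q = some (σ.action, q') → 𝒜.δ ℓ σ ℓ' →
      Strategy.Trans ψ (some (ℓ, q)) σ (ψ.target ℓ' q')
  | both {ℓ ℓ₁ ℓ₂ : 𝒜.Loc} {q q' : ψ.Mem} {i : I} {d : Bool} :
      ψ.next ℓ q = some (.prob i, q') →
      𝒜.δ ℓ (.prob i d) ℓ₁ → 𝒜.δ ℓ (.prob i (!d)) ℓ₂ → ψ.Dom ℓ₁ q' → ψ.Dom ℓ₂ q' →
      Strategy.Trans ψ (some (ℓ, q)) (.prob i d) (ψ.target ℓ₁ q')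
  | single {ℓ ℓ' : 𝒜.Loc} {q q' : ψ.Mem} {i : I} {d : Bool} :
      ψ.next ℓ q = some (.prob i, q') → 𝒜.δ ℓ (.prob i d) ℓ' →
      ((∃ ℓ'', 𝒜.δ ℓ (.prob i (!d)) ℓ'' ∧ ¬ ψ.Dom ℓ'' q') ∨
        ∀ ℓ'', ¬ 𝒜.δ ℓ (.prob i (!d)) ℓ'') →
      Strategy.Trans ψ (some (ℓ, q)) (.prob i d) (ψ.target ℓ' q')

/-- The model induced by applying a strategy. -/
noncomputable def PCFA.apply (𝒜 : PCFA (Label B N I)) (ψ : Strategy 𝒜) :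
    PCFA (Label B N I) where
  Loc := Option (𝒜.Loc × ψ.Mem)
  finite_loc := by
    have := 𝒜.finite_loc
    have := ψ.finite_mem
    infer_instance
  δ := ψ.Trans
  start := ψ.target 𝒜.start ψ.start
  final := none

/-- The violation probability of a program for the specification `(φe, φf)`. -/
noncomputable def violationProb (sem : B → State → Option State) (P : PCFA (Label B N I))
    (φe φf : Set State) : ℝ≥0∞ :=
  ⨆ s ∈ φe, ⨆ ψ : Strategy P,
    ∑' τ : (P.apply ψ).language, wt (τ : Trace B N I) * (wp sem (τ : Trace B N I) φfᶜ).indicator 1 s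

/-- The program satisfies the specification `(φe, φf)` with threshold `β`. -/
def Satisfies (sem : B → State → Option State) (P : PCFA (Label B N I))
    (φe φf : Set State) (β : ℝ≥0) : Prop :=
  violationProb sem P φe φf ≤ β

/-- A set of traces is mergeable if it is the set of accepting traces of a CFMC. -/
def Mergeable (Θ : Set (Trace B N I)) : Prop :=
  ∃ ℳ : PCFA (Label B N I), ℳ.IsCFMC ∧ ℳ.language = Θ

/-- MDP upper bound of a set of traces: the largest total weight of a mergeable subset,
irrespective of the semantics of the traces. -/
noncomputable def upperBound (Θ : Set (Trace B N I)) : ℝ≥0∞ :=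
  ⨆ Ξ : Set (Trace B N I), ⨆ _ : Ξ ⊆ Θ ∧ Mergeable Ξ, weight Ξ

/-- Two traces coincide up to a point where they take the two different branches of the same
probabilistic choice. -/
def BranchAtProb (τ₁ τ₂ : Trace B N I) : Prop :=
  ∃ (ρ : Trace B N I) (i : I) (d : Bool) (ρ₁ ρ₂ : Trace B N I),
    τ₁ = ρ ++ Label.prob i d :: ρ₁ ∧ τ₂ = ρ ++ Label.prob i (!d) :: ρ₂

/-- Counterexample `(S, φerr)` of a program for `(φe, φf)` with threshold `β`. -/
structure IsCounterexample (sem : B → State → Option State) (P : PCFA (Label B N I))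
    (φe φf : Set State) (β : ℝ≥0) (S : Set (Trace B N I)) (φerr : Set State) : Prop where
  subset : S ⊆ P.language
  branch : S.Pairwise BranchAtProb
  satisfiable : φerr.Nonempty
  implies_pre : φerr ⊆ φe
  violates : ∀ s ∈ φerr, ∀ τ ∈ S, s ∈ wp sem τ φfᶜ
  exceeds : (β : ℝ≥0∞) < weight S

end Models

section Algorithm

variable {B N I State : Type*}

/-- The trace violates the specification from some initial state. -/
def Violating (sem : B → State → Option State) (φe φf : Set State) (τ : Trace B N I) : Prop :=
  (φe ∩ wp sem τ φfᶜ).Nonempty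

/-- A branch `assume cond` of the split repository, with the traces kept on that branch. -/
structure Cell (B N I State : Type*) where
  cond : Set State
  traces : Set (Trace B N I)

/-- Conjunction of the precondition, a split condition, and the path conditions (to a violation)
of a set `S` of traces. -/
def totalPre (sem : B → State → Option State) (φe φf cond : Set State)
    (S : Set (Trace B N I)) : Set State :=
  {s | s ∈ φe ∧ s ∈ cond ∧ ∀ τ ∈ S, s ∈ wp sem τ φfᶜ}

/-- A trace is fake under a split condition if it cannot violate from there. -/
def Fake (sem : B → State → Option State) (φe φf cond : Set State) (τ : Trace B N I) : Prop :=
  totalPre sem φe φf cond {τ} = ∅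

/-- MDP upper bound of a split repository: a CFMC chooses one of the `assume` branches. -/
noncomputable def splitUpperBound (C : Multiset (Cell B N I State)) : ℝ≥0∞ :=
  ⨆ c ∈ C, upperBound c.traces

/-- Language of the certified module, a finite union of automata. -/
def certified (Q : List (PCFA (Label B N I))) : Set (Trace B N I) :=
  {τ | ∃ 𝒬 ∈ Q, τ ∈ 𝒬.language}

/-- Traces of the program that are in neither module. -/
def remaining (P : PCFA (Label B N I)) (Q : List (PCFA (Label B N I))) (A : Set (Trace B N I)) :
    Set (Trace B N I) :=
  P.language \ (certified Q ∪ A)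

/-- Configurations of the algorithm. `Q` is the certified module and `A` the repository of the
violating traces found so far.
* `main`: head of the main loop.
* `examine`: head of the examination loop; `C` is the current split form of `A`.
* `verify`: the traces of a reason CFMC with trace set `M`, which belongs to the cell `c` (the other
  cells are `C`), are being verified one by one; those verified so far are divided into the
  mainstream `S`, the fake traces `F` and the violating but incompatible traces `J`.
* `sat`, `unsat S φerr`: the two answers. -/
inductive Config (B N I State : Type*) where
  | main (Q : List (PCFA (Label B N I))) (A : Set (Trace B N I))
  | examine (Q : List (PCFA (Label B N I))) (A : Set (Trace B N I))
      (C : Multiset (Cell B N I State))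
  | verify (Q : List (PCFA (Label B N I))) (A : Set (Trace B N I))
      (C : Multiset (Cell B N I State)) (c : Cell B N I State) (M S F J : Set (Trace B N I))
  | sat
  | unsat (S : Set (Trace B N I)) (φerr : Set State)

/-- Initially both modules are empty. -/
def Config.initial : Config B N I State := .main [] ∅

/-- `τ` may be the next trace to pick in the main loop: the upper bound does not yet show
satisfaction, and `τ` is a remaining trace of minimal length. -/
structure Picks (P : PCFA (Label B N I)) (β : ℝ≥0) (Q : List (PCFA (Label B N I)))
    (A : Set (Trace B N I)) (τ : Trace B N I) : Prop where
  not_sat : ¬ upperBound (remaining P Q A ∪ A) ≤ β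
  mem : τ ∈ remaining P Q A
  shortest : ∀ τ' ∈ remaining P Q A, τ.length ≤ τ'.length

/-- `τ` may be the next trace to verify in the reason CFMC: neither stopping criterion of the
verification is met, and `τ` has maximal weight among the traces not verified yet. -/
structure Verifies (β : ℝ≥0) (M S F J : Set (Trace B N I)) (τ : Trace B N I) : Prop where
  no_counterexample : ¬ (β : ℝ≥0∞) < weight S
  no_certificate : ¬ weight M ≤ β + weight (F ∪ J)
  mem : τ ∈ M \ (S ∪ F ∪ J)
  heaviest : ∀ τ' ∈ M \ (S ∪ F ∪ J), wt τ' ≤ wt τ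

/-- One step of the algorithm. All choices the algorithm is free to make (which of the shortest
traces is picked, how non-violating and fake traces are generalised, which reason CFMC is taken,
which of the heaviest traces is verified first) are left open. -/
inductive Step (sem : B → State → Option State) (P : PCFA (Label B N I)) (φe φf : Set State)
    (β : ℝ≥0) : Config B N I State → Config B N I State → Prop
  -- Main loop: the answer SAT.
  | sat_bound {Q A} : upperBound (remaining P Q A ∪ A) ≤ β →
      Step sem P φe φf β (.main Q A) .sat
  | sat_covered {Q A} : remaining P Q A = ∅ →
      Step sem P φe φf β (.main Q A) .sat
  -- A non-violating trace is generalised to an automaton that accepts it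
  -- and accepts non-violating traces only.
  | certify {Q A τ} (𝒬 : PCFA (Label B N I)) : Picks P β Q A τ →
      ¬ Violating sem φe φf τ →
      τ ∈ 𝒬.language → (∀ τ' ∈ 𝒬.language, ¬ Violating sem φe φf τ') →
      Step sem P φe φf β (.main Q A) (.main (𝒬 :: Q) A)
  -- A violating trace that is a counterexample on its own.
  | unsat_single {Q A τ} : Picks P β Q A τ →
      Violating sem φe φf τ → (β : ℝ≥0∞) < wt τ →
      Step sem P φe φf β (.main Q A) (.unsat {τ} (φe ∩ wp sem τ φfᶜ))
  -- Any other violating trace is stored, without generalisation, and the repository is examined.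
  | store {Q A τ} : Picks P β Q A τ →
      Violating sem φe φf τ → wt τ ≤ β →
      Step sem P φe φf β (.main Q A) (.examine Q (insert τ A) {⟨Set.univ, insert τ A⟩})
  -- Examination: the repository is found to be non-violating.
  | confirmed {Q A C} : splitUpperBound C ≤ β →
      Step sem P φe φf β (.examine Q A C) (.main Q A)
  -- Examination: a reason CFMC, that is, one that attains the upper bound, is taken.
  | reason {Q A C c M} : ¬ splitUpperBound (c ::ₘ C) ≤ β →
      M ⊆ c.traces → Mergeable M → weight M = splitUpperBound (c ::ₘ C) →
      Step sem P φe φf β (.examine Q A (c ::ₘ C)) (.verify Q A C c M ∅ ∅ ∅)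
  -- Verification of a trace of the reason CFMC.
  | fake {Q A C c M S F J τ} : Verifies β M S F J τ →
      Fake sem φe φf c.cond τ →
      Step sem P φe φf β (.verify Q A C c M S F J) (.verify Q A C c M S (insert τ F) J)
  | compatible {Q A C c M S F J τ} : Verifies β M S F J τ →
      (totalPre sem φe φf c.cond (insert τ S)).Nonempty →
      Step sem P φe φf β (.verify Q A C c M S F J) (.verify Q A C c M (insert τ S) F J)
  | incompatible {Q A C c M S F J τ} : Verifies β M S F J τ →
      ¬ Fake sem φe φf c.cond τ → totalPre sem φe φf c.cond (insert τ S) = ∅ →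
      Step sem P φe φf β (.verify Q A C c M S F J) (.verify Q A C c M S F (insert τ J))
  -- The mainstream has become a counterexample.
  | unsat_mainstream {Q A C c M S F J} : (β : ℝ≥0∞) < weight S →
      Step sem P φe φf β (.verify Q A C c M S F J) (.unsat S (totalPre sem φe φf c.cond S))
  -- A safe certificate without incompatible traces: the fake traces, generalised to a set `E` of
  -- fake traces, are erased.
  | erase {Q A C c M S F E} : ¬ (β : ℝ≥0∞) < weight S → weight M ≤ β + weight F →
      F ⊆ E → (∀ τ ∈ E, Fake sem φe φf c.cond τ) →
      Step sem P φe φf β (.verify Q A C c M S F ∅)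
        (.examine Q A (⟨c.cond, c.traces \ E⟩ ::ₘ C))
  -- A semi-safe certificate with incompatible traces: fake traces are erased as above, and the cell
  -- is split by the total precondition `H` of the mainstream; the incompatible traces are erased
  -- under `H`, the mainstream traces that have become fake are erased under its negation.
  | split {Q A C c M S F J E H} : ¬ (β : ℝ≥0∞) < weight S → weight M ≤ β + weight (F ∪ J) →
      J.Nonempty → F ⊆ E → (∀ τ ∈ E, Fake sem φe φf c.cond τ) →
      H = totalPre sem φe φf c.cond S →
      Step sem P φe φf β (.verify Q A C c M S F J)
        (.examine Q A (⟨H, c.traces \ (E ∪ J)⟩ ::ₘ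
          ⟨c.cond \ H, c.traces \ (E ∪ {τ ∈ S | Fake sem φe φf (c.cond \ H) τ})⟩ ::ₘ C))

end Algorithm

end ProbTA

/-! A violated specification already has a finite reason. The violation probability is a supremum
over states and strategies of sums of nonnegative terms, so some state `s` and some finite set `D`
of traces of one induced CFMC, all violating from `s`, have weight above `β`
(`exists_violationWitness`). `D` is itself mergeable, because finite mergeable sets are exactly the
finite sets whose members pairwise separate at a probabilistic choice (`Mergeable.pairwise`,
`mergeable_of_finite`).

The algorithm cannot lose `D`. Its traces are violating, hence never certified. Once `D` is stored,
some cell has `s` in its condition and all of `D` among its traces: the two conditions of a split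
cover the old one, and no erased trace can belong to `D` in the cell that receives `s`. So SAT is
never answered, and the examination cannot be confirmed after `D` is stored
(`ViolationWitness.inv_step`).

Termination is a lexicographic descent (`ViolationWitness.rank_lt_of_step`). While part of `D` is
missing from the repository, a shortest remaining trace is no longer than the longest trace of `D`,
and there are only finitely many such traces. Within an examination each cell is replaced by at most
two strictly smaller ones, and each verification uses up a finite set. Since every configuration
other than the answers has a successor, a run that cannot be continued ends in `unsat`, whose
correctness is part of the invariant. -/

namespace ProbTA

/-! ### Weights, and branching of the traces of a CFMC -/

section Traces

variable {B N I State : Type*}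

instance [Finite B] [Finite N] [Finite I] : Finite (Label B N I) := by
  let f : Label B N I → B ⊕ N ⊕ (I × Bool)
    | .stmt b => .inl b
    | .nondet j => .inr (.inl j)
    | .prob i d => .inr (.inr (i, d))
  refine Finite.of_injective f ?_
  rintro (_ | _ | _) (_ | _ | _) h <;> simp_all [f]

theorem weight_eq_tsum_indicator (Θ : Set (Trace B N I)) :
    weight Θ = ∑' τ, Θ.indicator wt τ :=
  tsum_subtype Θ wt

theorem weight_singleton (τ : Trace B N I) : weight {τ} = wt τ := by
  rw [weight, tsum_singleton τ wt]

theorem weight_empty : weight (∅ : Set (Trace B N I)) = 0 := by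
  simp [weight]

theorem weight_union_le (Θ Ξ : Set (Trace B N I)) : weight (Θ ∪ Ξ) ≤ weight Θ + weight Ξ :=
  ENNReal.tsum_union_le wt Θ Ξ

theorem nonempty_of_lt_weight {Θ : Set (Trace B N I)} {b : ℝ≥0∞} (h : b < weight Θ) :
    Θ.Nonempty := by
  by_contra hΘ
  rw [Set.not_nonempty_iff_eq_empty] at hΘ
  simp [hΘ, weight_empty] at h

theorem BranchAtProb.cons {τ₁ τ₂ : Trace B N I} (h : BranchAtProb τ₁ τ₂) (σ : Label B N I) :
    BranchAtProb (σ :: τ₁) (σ :: τ₂) := by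
  obtain ⟨ρ, i, d, ρ₁, ρ₂, rfl, rfl⟩ := h
  exact ⟨σ :: ρ, i, d, ρ₁, ρ₂, rfl, rfl⟩

theorem branchAtProb_cons_cons {σ₁ σ₂ : Label B N I} {τ₁ τ₂ : Trace B N I}
    (h : BranchAtProb (σ₁ :: τ₁) (σ₂ :: τ₂)) :
    σ₁.action = σ₂.action ∧ (σ₁ = σ₂ → BranchAtProb τ₁ τ₂) := by
  obtain ⟨ρ, i, d, ρ₁, ρ₂, h₁, h₂⟩ := h
  cases ρ with
  | nil =>
    simp only [List.nil_append, List.cons.injEq] at h₁ h₂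
    obtain ⟨rfl, rfl⟩ := h₁
    obtain ⟨rfl, rfl⟩ := h₂
    exact ⟨rfl, fun h => by simp at h⟩
  | cons σ ρ =>
    simp only [List.cons_append, List.cons.injEq] at h₁ h₂
    obtain ⟨rfl, rfl⟩ := h₁
    obtain ⟨rfl, rfl⟩ := h₂
    exact ⟨rfl, fun _ => ⟨ρ, i, d, ρ₁, ρ₂, rfl, rfl⟩⟩

theorem not_branchAtProb_nil_right (τ : Trace B N I) : ¬ BranchAtProb τ [] := by
  rintro ⟨ρ, i, d, ρ₁, ρ₂, -, h⟩
  simp at h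

/-- By determinism the two paths share locations until their labels first differ. There both labels
belong to the one available action, which forces the two sides of a probabilistic choice. Neither
trace can be a proper prefix of the other, as the ending location has no way out. -/
theorem PCFA.IsCFMC.branchAtProb_of_path {ℳ : PCFA (Label B N I)} (hℳ : ℳ.IsCFMC)
    {τ₁ τ₂ : Trace B N I} {ℓ : ℳ.Loc} (h₁ : ℳ.Path ℓ τ₁ ℳ.final) (h₂ : ℳ.Path ℓ τ₂ ℳ.final)
    (hne : τ₁ ≠ τ₂) : BranchAtProb τ₁ τ₂ := by
  induction τ₁ generalizing ℓ τ₂ with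
  | nil =>
    obtain rfl : ℓ = ℳ.final := h₁
    cases τ₂ with
    | nil => exact absurd rfl hne
    | cons σ τ₂ =>
      obtain ⟨m, hm, -⟩ := h₂
      exact absurd hm (hℳ.no_out _ _)
  | cons σ₁ τ₁ ih =>
    obtain ⟨m₁, hm₁, hp₁⟩ := h₁
    cases τ₂ with
    | nil =>
      obtain rfl : ℓ = ℳ.final := h₂
      exact absurd hm₁ (hℳ.no_out _ _)
    | cons σ₂ τ₂ =>
      obtain ⟨m₂, hm₂, hp₂⟩ := h₂
      by_cases hσ : σ₁ = σ₂
      · subst hσ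
        obtain rfl := hℳ.deterministic _ _ _ _ hm₁ hm₂
        exact (ih hp₁ hp₂ fun h => hne (by rw [h])).cons σ₁
      · have ha := hℳ.one_action _ _ _ _ _ hm₁ hm₂
        cases σ₁ <;> cases σ₂ <;> cases ha
        · exact absurd rfl hσ
        · exact absurd rfl hσ
        · rename_i i d d'
          obtain rfl : d' = !d := by
            cases d <;> cases d' <;> first | rfl | exact absurd rfl hσ
          exact ⟨[], i, d, τ₁, τ₂, rfl, rfl⟩

theorem Mergeable.pairwise {Θ : Set (Trace B N I)} (h : Mergeable Θ) :
    Θ.Pairwise BranchAtProb := by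
  obtain ⟨ℳ, hℳ, rfl⟩ := h
  exact fun τ₁ h₁ τ₂ h₂ hne => hℳ.branchAtProb_of_path h₁ h₂ hne

/-! ### Residual automata: finite branching sets are mergeable -/

/-- The locations of the residual automaton: sets of traces of bounded length,
any two of which branch at a probabilistic choice. -/
abbrev Residuals (B N I : Type*) (n : ℕ) :=
  {X : Set (Trace B N I) // X ⊆ {τ | τ.length ≤ n} ∧ X.Pairwise BranchAtProb}

instance [Finite B] [Finite N] [Finite I] (n : ℕ) : Finite (Residuals B N I n) :=
  ((List.finite_length_le (Label B N I) n).finite_subsets.subset fun _ h => h.1).to_subtype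

/-- Locations of the residual automaton, moved to the lowest universe. -/
noncomputable def residualEquiv (B N I : Type*) [Finite B] [Finite N] [Finite I] (n : ℕ) :
    Residuals B N I n ≃ Shrink.{0} (Residuals B N I n) :=
  equivShrink _

/-- The automaton whose locations are the residuals of a language. -/
noncomputable def residualAutomaton [Finite B] [Finite N] [Finite I] (n : ℕ)
    (X : Residuals B N I n) : PCFA (Label B N I) where
  Loc := Shrink.{0} (Residuals B N I n)
  finite_loc := Finite.of_equiv _ (residualEquiv B N I n)
  δ ℓ σ ℓ' := ((residualEquiv B N I n).symm ℓ').1 =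
      {τ | σ :: τ ∈ ((residualEquiv B N I n).symm ℓ).1} ∧
    ((residualEquiv B N I n).symm ℓ').1.Nonempty
  start := residualEquiv B N I n X
  final := residualEquiv B N I n ⟨{[]}, by simp, by simp⟩

variable [Finite B] [Finite N] [Finite I] {n : ℕ}

/-- The residual that a location of the residual automaton stands for. -/
noncomputable def residual (X : Residuals B N I n) :
    (residualAutomaton n X).Loc ≃ Residuals B N I n :=
  (residualEquiv B N I n).symm

theorem residual_start (X : Residuals B N I n) :
    residual X (residualAutomaton n X).start = X :=
  (residualEquiv B N I n).symm_apply_apply X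

theorem residual_final (X : Residuals B N I n) :
    (residual X (residualAutomaton n X).final).1 = {[]} :=
  congrArg Subtype.val ((residualEquiv B N I n).symm_apply_apply _)

theorem residualAutomaton_δ (X : Residuals B N I n) (ℓ ℓ' : (residualAutomaton n X).Loc)
    (σ : Label B N I) : (residualAutomaton n X).δ ℓ σ ℓ' ↔
      (residual X ℓ').1 = {τ | σ :: τ ∈ (residual X ℓ).1} ∧ (residual X ℓ').1.Nonempty :=
  Iff.rfl

theorem residualAutomaton_path (X : Residuals B N I n)
    (ℓ : (residualAutomaton n X).Loc) (τ : Trace B N I) :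
    (residualAutomaton n X).Path ℓ τ (residualAutomaton n X).final ↔ τ ∈ (residual X ℓ).1 := by
  induction τ generalizing ℓ with
  | nil =>
    change ℓ = (residualAutomaton n X).final ↔ _
    rw [← (residual X).injective.eq_iff, Subtype.ext_iff, residual_final]
    constructor
    · intro h
      rw [h]
      rfl
    · intro h
      -- The empty trace branches from no other trace, so a residual containing it contains nothing
      -- else; hence one ending location suffices.
      refine Set.eq_singleton_iff_unique_mem.2 ⟨h, fun τ hτ => ?_⟩
      by_contra hne
      exact not_branchAtProb_nil_right _ ((residual X ℓ).2.2 hτ h hne)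
  | cons σ τ ih =>
    change (∃ m, (residualAutomaton n X).δ ℓ σ m ∧ (residualAutomaton n X).Path m τ _) ↔ _
    constructor
    · rintro ⟨m, hδ, hp⟩
      rw [residualAutomaton_δ] at hδ
      rw [ih, hδ.1] at hp
      exact hp
    · intro h
      let Y : Residuals B N I n := ⟨{τ | σ :: τ ∈ (residual X ℓ).1},
        fun τ hτ => by
          have := (residual X ℓ).2.1 hτ
          simp only [Set.mem_ofPred_eq, List.length_cons] at this ⊢
          omega,
        fun τ₁ h₁ τ₂ h₂ hne => (branchAtProb_cons_cons
          ((residual X ℓ).2.2 h₁ h₂ fun he => hne (List.cons.inj he).2)).2 rfl⟩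
      refine ⟨(residual X).symm Y, ?_, ?_⟩
      · rw [residualAutomaton_δ, Equiv.apply_symm_apply]
        exact ⟨rfl, τ, h⟩
      · rw [ih, Equiv.apply_symm_apply]
        exact h

theorem residualAutomaton_language (X : Residuals B N I n) :
    (residualAutomaton n X).language = X.1 := by
  ext τ
  change (residualAutomaton n X).Path _ τ _ ↔ _
  rw [residualAutomaton_path, residual_start]

/-- The nonemptiness required of a target matters twice: it leaves the residual `{[]}` without
outgoing edges, and it provides for each edge a trace starting with its label, so that branching
forces a single action. -/
theorem residualAutomaton_isCFMC (X : Residuals B N I n) : (residualAutomaton n X).IsCFMC where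
  deterministic ℓ σ ℓ₁ ℓ₂ h₁ h₂ := by
    rw [residualAutomaton_δ] at h₁ h₂
    exact (residual X).injective (Subtype.ext (h₁.1.trans h₂.1.symm))
  no_out σ ℓ h := by
    rw [residualAutomaton_δ, residual_final] at h
    obtain ⟨h, τ, hτ⟩ := h
    rw [h] at hτ
    simp at hτ
  one_action ℓ σ₁ σ₂ ℓ₁ ℓ₂ h₁ h₂ := by
    rw [residualAutomaton_δ] at h₁ h₂
    obtain ⟨h₁, τ₁, hτ₁⟩ := h₁
    obtain ⟨h₂, τ₂, hτ₂⟩ := h₂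
    rw [h₁] at hτ₁
    rw [h₂] at hτ₂
    by_cases he : σ₁ :: τ₁ = σ₂ :: τ₂
    · rw [(List.cons.inj he).1]
    · exact (branchAtProb_cons_cons ((residual X ℓ).2.2 hτ₁ hτ₂ he)).1

theorem mergeable_of_finite {Θ : Set (Trace B N I)} (hf : Θ.Finite)
    (h : Θ.Pairwise BranchAtProb) : Mergeable Θ := by
  obtain ⟨n, hn⟩ := (hf.image List.length).bddAbove
  let X : Residuals B N I n := ⟨Θ, fun τ hτ => hn ⟨τ, hτ, rfl⟩, h⟩
  exact ⟨residualAutomaton n X, residualAutomaton_isCFMC X, residualAutomaton_language X⟩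

end Traces

/-! ### Induced models, and a finite witness of violation -/

section Strategies

variable {B N I State : Type*} {P : PCFA (Label B N I)}

theorem Strategy.eq_some_of_trans {ψ : Strategy P} {ℓ : P.Loc} {q : ψ.Mem} {σ : Label B N I}
    {m : Option (P.Loc × ψ.Mem)} (h : ψ.Trans (ψ.target ℓ q) σ m) :
    ∃ ℓ' q', ψ.next ℓ q = some (σ.action, q') ∧ P.δ ℓ σ ℓ' ∧ m = ψ.target ℓ' q' := by
  generalize hx : ψ.target ℓ q = x at h
  unfold Strategy.target at hx
  cases h <;> split_ifs at hx <;> cases hx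
  · exact ⟨_, _, ‹_›, ‹_›, rfl⟩
  · exact ⟨_, _, ‹_›, ‹_›, rfl⟩
  · exact ⟨_, _, ‹_›, ‹_›, rfl⟩

theorem Strategy.trans_some {ψ : Strategy P} {x m : Option (P.Loc × ψ.Mem)} {σ : Label B N I}
    (h : ψ.Trans x σ m) :
    ∃ ℓ q ℓ' q', x = some (ℓ, q) ∧ ψ.next ℓ q = some (σ.action, q') ∧ P.δ ℓ σ ℓ' ∧
      m = ψ.target ℓ' q' := by
  cases h
  · exact ⟨_, _, _, _, rfl, ‹_›, ‹_›, rfl⟩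
  · exact ⟨_, _, _, _, rfl, ‹_›, ‹_›, rfl⟩
  · exact ⟨_, _, _, _, rfl, ‹_›, ‹_›, rfl⟩

/-- The strategy fixes the action and the next memory state, determinism of `P` the next location,
and no rule leaves `none`. -/
theorem PCFA.IsCFMDP.apply_isCFMC (hP : P.IsCFMDP) (ψ : Strategy P) : (P.apply ψ).IsCFMC where
  deterministic x σ m₁ m₂ h₁ h₂ := by
    obtain ⟨ℓ, q, ℓ₁, q₁, rfl, hn₁, hδ₁, rfl⟩ := Strategy.trans_some h₁
    obtain ⟨_, _, ℓ₂, q₂, he, hn₂, hδ₂, rfl⟩ := Strategy.trans_some h₂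
    cases he
    obtain rfl := hP.deterministic _ _ _ _ hδ₁ hδ₂
    rw [hn₁] at hn₂
    cases hn₂
    rfl
  no_out σ m h := by
    obtain ⟨ℓ, q, ℓ₁, q₁, he, -⟩ := Strategy.trans_some h
    cases he
  one_action x σ₁ σ₂ m₁ m₂ h₁ h₂ := by
    obtain ⟨ℓ, q, ℓ₁, q₁, rfl, hn₁, -⟩ := Strategy.trans_some h₁
    obtain ⟨_, _, ℓ₂, q₂, he, hn₂, -⟩ := Strategy.trans_some h₂
    cases he
    rw [hn₁] at hn₂
    simp only [Option.some.injEq, Prod.mk.injEq] at hn₂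
    exact hn₂.1

theorem PCFA.path_of_apply_path {ψ : Strategy P} {τ : Trace B N I} {ℓ : P.Loc} {q : ψ.Mem}
    (h : (P.apply ψ).Path (ψ.target ℓ q) τ none) : P.Path ℓ τ P.final := by
  induction τ generalizing ℓ q with
  | nil =>
    have h : ψ.target ℓ q = none := h
    unfold Strategy.target at h
    split_ifs at h with hℓ
    exact hℓ
  | cons σ τ ih =>
    obtain ⟨m, hm, hp⟩ := h
    obtain ⟨ℓ', q', -, hδ, rfl⟩ := Strategy.eq_some_of_trans hm
    exact ⟨ℓ', hδ, ih hp⟩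

theorem PCFA.apply_language_subset (ψ : Strategy P) : (P.apply ψ).language ⊆ P.language :=
  fun _ h => PCFA.path_of_apply_path h

/-- A finite mergeable set `D` of traces that all violate from the initial state `s`, and whose
weight exceeds the threshold. -/
structure ViolationWitness (sem : B → State → Option State) (P : PCFA (Label B N I))
    (φe φf : Set State) (β : ℝ≥0) (s : State) (D : Set (Trace B N I)) : Prop where
  finite : D.Finite
  mergeable : Mergeable D
  subset : D ⊆ P.language
  pre : s ∈ φe
  violates : ∀ τ ∈ D, s ∈ wp sem τ φfᶜ
  exceeds : (β : ℝ≥0∞) < weight D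

theorem exists_violationWitness [Finite B] [Finite N] [Finite I]
    {sem : B → State → Option State} (hP : P.IsCFMDP) {φe φf : Set State} {β : ℝ≥0}
    (h : ¬ Satisfies sem P φe φf β) : ∃ s D, ViolationWitness sem P φe φf β s D := by
  classical
  simp only [Satisfies, violationProb, not_le, lt_iSup_iff, ENNReal.tsum_eq_iSup_sum] at h
  obtain ⟨s, hs, ψ, t, ht⟩ := h
  -- Traces of `t` that do not violate from `s` contribute zero to the partial sum, so dropping them
  -- keeps its value.
  let D : Set (Trace B N I) := {τ | (∃ h, (⟨τ, h⟩ : (P.apply ψ).language) ∈ t) ∧ s ∈ wp sem τ φfᶜ}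
  have hfin : D.Finite := by
    refine (t.finite_toSet.image Subtype.val).subset ?_
    rintro τ ⟨⟨h, hτ⟩, -⟩
    exact ⟨_, hτ, rfl⟩
  have hsub : D ⊆ (P.apply ψ).language := fun τ hτ => hτ.1.1
  refine ⟨s, D, hfin, mergeable_of_finite hfin ?_, hsub.trans (PCFA.apply_language_subset ψ), hs,
    fun τ hτ => hτ.2, ht.trans_le ?_⟩
  · exact (Mergeable.pairwise ⟨_, hP.apply_isCFMC ψ, rfl⟩).mono hsub
  · rw [weight_eq_tsum_indicator]
    refine le_trans (le_of_eq ?_) (ENNReal.sum_le_tsum (t.map (Function.Embedding.subtype _)))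
    rw [Finset.sum_map]
    refine Finset.sum_congr rfl fun τ hτ => ?_
    by_cases hw : s ∈ wp sem (τ : Trace B N I) φfᶜ
    · have : (τ : Trace B N I) ∈ D := ⟨⟨τ.2, hτ⟩, hw⟩
      simp [hw, this]
    · have : (τ : Trace B N I) ∉ D := fun h => hw h.2
      simp [hw, this]

end Strategies

end ProbTA

namespace ProbTA

/-! ### Invariants: the witness survives -/

section Algorithm

variable {B N I State : Type*} {sem : B → State → Option State} {P : PCFA (Label B N I)}
  {φe φf : Set State} {β : ℝ≥0} {s : State} {D : Set (Trace B N I)}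

theorem totalPre_anti {G : Set State} {S S' : Set (Trace B N I)} (h : S ⊆ S') :
    totalPre sem φe φf G S' ⊆ totalPre sem φe φf G S :=
  fun _ hs => ⟨hs.1, hs.2.1, fun τ hτ => hs.2.2 τ (h hτ)⟩

theorem totalPre_mono_cond {G G' : Set State} (h : G ⊆ G') (S : Set (Trace B N I)) :
    totalPre sem φe φf G S ⊆ totalPre sem φe φf G' S :=
  fun _ hs => ⟨hs.1, h hs.2.1, hs.2.2⟩

theorem not_fake_of_mem {G : Set State} {τ : Trace B N I} (hs : s ∈ φe) (hG : s ∈ G)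
    (hτ : s ∈ wp sem τ φfᶜ) : ¬ Fake sem φe φf G τ := by
  intro h
  have : s ∈ totalPre sem φe φf G {τ} := ⟨hs, hG, by simpa using hτ⟩
  rw [h] at this
  exact this

theorem ViolationWitness.violating (w : ViolationWitness sem P φe φf β s D) {τ : Trace B N I}
    (hτ : τ ∈ D) : Violating sem φe φf τ :=
  ⟨s, w.pre, w.violates τ hτ⟩

theorem ViolationWitness.lt_upperBound (w : ViolationWitness sem P φe φf β s D)
    {T : Set (Trace B N I)} (h : D ⊆ T) : (β : ℝ≥0∞) < upperBound T :=
  w.exceeds.trans_le (le_iSup₂_of_le D ⟨h, w.mergeable⟩ le_rfl)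

theorem ViolationWitness.exists_mem_remaining (w : ViolationWitness sem P φe φf β s D)
    {Q : List (PCFA (Label B N I))} {A : Set (Trace B N I)}
    (hQ : ∀ τ ∈ certified Q, ¬ Violating sem φe φf τ) (hD : ¬ D ⊆ A) :
    ∃ τ ∈ D, τ ∈ remaining P Q A := by
  obtain ⟨τ, hτ, hA⟩ := Set.not_subset.1 hD
  refine ⟨τ, hτ, w.subset hτ, ?_⟩
  rintro (h | h)
  · exact hQ τ h (w.violating hτ)
  · exact hA h

theorem ViolationWitness.subset_remaining_union (w : ViolationWitness sem P φe φf β s D)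
    {Q : List (PCFA (Label B N I))} (A : Set (Trace B N I))
    (hQ : ∀ τ ∈ certified Q, ¬ Violating sem φe φf τ) : D ⊆ remaining P Q A ∪ A := by
  intro τ hτ
  by_cases hA : τ ∈ A
  · exact .inr hA
  · refine .inl ⟨w.subset hτ, ?_⟩
    rintro (h | h)
    · exact hQ τ h (w.violating hτ)
    · exact hA h

/-- Invariant of the repository and the certified module. -/
structure ModuleInv (sem : B → State → Option State) (P : PCFA (Label B N I))
    (φe φf : Set State) (Q : List (PCFA (Label B N I))) (A : Set (Trace B N I)) : Prop where
  finite : A.Finite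
  subset : A ⊆ P.language
  certified : ∀ τ ∈ certified Q, ¬ Violating sem φe φf τ

/-- Invariant of the split repository: if the witness has been found,
then it survives in some cell. -/
structure CellsInv (s : State) (D A : Set (Trace B N I)) (C : Multiset (Cell B N I State)) :
    Prop where
  subset : ∀ c ∈ C, c.traces ⊆ A
  survives : D ⊆ A → ∃ c ∈ C, s ∈ c.cond ∧ D ⊆ c.traces

/-- Invariant of the verification of the traces of a reason CFMC. -/
structure VerifyInv (sem : B → State → Option State) (φe φf : Set State) (β : ℝ≥0)
    (c : Cell B N I State) (M S F J : Set (Trace B N I)) : Prop where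
  reason_subset : M ⊆ c.traces
  mergeable : Mergeable M
  exceeds : (β : ℝ≥0∞) < weight M
  subset : S ∪ F ∪ J ⊆ M
  fake : ∀ τ ∈ F, Fake sem φe φf c.cond τ
  compatible : S.Nonempty → (totalPre sem φe φf c.cond S).Nonempty
  incompatible : ∀ τ ∈ J, totalPre sem φe φf c.cond (insert τ S) = ∅
  mainstream : J.Nonempty → S.Nonempty

/-- Invariant of the algorithm for a violated specification. -/
def Config.Inv (sem : B → State → Option State) (P : PCFA (Label B N I)) (φe φf : Set State)
    (β : ℝ≥0) (s : State) (D : Set (Trace B N I)) : Config B N I State → Prop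
  | .main Q A => ModuleInv sem P φe φf Q A ∧ ¬ D ⊆ A
  | .examine Q A C => ModuleInv sem P φe φf Q A ∧ CellsInv s D A C
  | .verify Q A C c M S F J => ModuleInv sem P φe φf Q A ∧ CellsInv s D A (c ::ₘ C) ∧
      VerifyInv sem φe φf β c M S F J
  | .sat => False
  | .unsat S φerr => S.Finite ∧ IsCounterexample sem P φe φf β S φerr

theorem ViolationWitness.inv_initial (w : ViolationWitness sem P φe φf β s D) :
    (Config.initial : Config B N I State).Inv sem P φe φf β s D := by
  refine ⟨⟨Set.finite_empty, Set.empty_subset _, ?_⟩, fun h => ?_⟩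
  · rintro τ ⟨𝒬, h, -⟩
    simp at h
  · obtain ⟨τ, hτ⟩ := nonempty_of_lt_weight w.exceeds
    exact h hτ

theorem CellsInv.erase {A E : Set (Trace B N I)} {c : Cell B N I State}
    {C : Multiset (Cell B N I State)} (w : ViolationWitness sem P φe φf β s D)
    (h : CellsInv s D A (c ::ₘ C)) (hE : ∀ τ ∈ E, Fake sem φe φf c.cond τ) :
    CellsInv s D A (⟨c.cond, c.traces \ E⟩ ::ₘ C) := by
  refine ⟨fun c' hc' => ?_, fun hD => ?_⟩
  · rcases Multiset.mem_cons.1 hc' with rfl | hc'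
    · exact Set.sdiff_subset.trans (h.subset c (Multiset.mem_cons_self c C))
    · exact h.subset c' (Multiset.mem_cons_of_mem hc')
  · obtain ⟨c', hc', hs, hDc⟩ := h.survives hD
    rcases Multiset.mem_cons.1 hc' with rfl | hc'
    · exact ⟨_, Multiset.mem_cons_self _ _, hs, fun τ hτ =>
        ⟨hDc hτ, fun hτE => not_fake_of_mem w.pre hs (w.violates τ hτ) (hE τ hτE)⟩⟩
    · exact ⟨c', Multiset.mem_cons_of_mem hc', hs, hDc⟩

/-- The witness follows its state `s`. If `s` satisfies the total precondition of `S`, an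
incompatible trace cannot violate from `s`, so it is not in `D`; otherwise `s` lies in the
complementary cell, where only traces that are fake at `s` are erased. -/
theorem CellsInv.split {A M S F J E : Set (Trace B N I)} {c : Cell B N I State}
    {C : Multiset (Cell B N I State)} (w : ViolationWitness sem P φe φf β s D)
    (h : CellsInv s D A (c ::ₘ C)) (hv : VerifyInv sem φe φf β c M S F J)
    (hE : ∀ τ ∈ E, Fake sem φe φf c.cond τ) :
    CellsInv s D A (⟨totalPre sem φe φf c.cond S, c.traces \ (E ∪ J)⟩ ::ₘ
      ⟨c.cond \ totalPre sem φe φf c.cond S,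
        c.traces \ (E ∪ {τ ∈ S | Fake sem φe φf (c.cond \ totalPre sem φe φf c.cond S) τ})⟩ ::ₘ
      C) := by
  refine ⟨fun c' hc' => ?_, fun hD => ?_⟩
  · rcases Multiset.mem_cons.1 hc' with rfl | hc'
    · exact Set.sdiff_subset.trans (h.subset c (Multiset.mem_cons_self c C))
    rcases Multiset.mem_cons.1 hc' with rfl | hc'
    · exact Set.sdiff_subset.trans (h.subset c (Multiset.mem_cons_self c C))
    · exact h.subset c' (Multiset.mem_cons_of_mem hc')
  · obtain ⟨c', hc', hs, hDc⟩ := h.survives hD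
    rcases Multiset.mem_cons.1 hc' with rfl | hc'
    · by_cases hH : s ∈ totalPre sem φe φf c'.cond S
      · refine ⟨_, Multiset.mem_cons_self _ _, hH, fun τ hτ => ⟨hDc hτ, ?_⟩⟩
        rintro (hτE | hτJ)
        · exact not_fake_of_mem w.pre hs (w.violates τ hτ) (hE τ hτE)
        · have : s ∈ totalPre sem φe φf c'.cond (insert τ S) := by
            refine ⟨hH.1, hH.2.1, ?_⟩
            rintro τ' (rfl | hτ')
            · exact w.violates _ hτ
            · exact hH.2.2 τ' hτ'
          rw [hv.incompatible τ hτJ] at this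
          exact this
      · refine ⟨_, Multiset.mem_cons_of_mem (Multiset.mem_cons_self _ _), ⟨hs, hH⟩,
          fun τ hτ => ⟨hDc hτ, ?_⟩⟩
        rintro (hτE | hτS)
        · exact not_fake_of_mem w.pre hs (w.violates τ hτ) (hE τ hτE)
        · exact not_fake_of_mem w.pre (Set.mem_sdiff_of_mem hs hH) (w.violates τ hτ) hτS.2
    · exact ⟨c', Multiset.mem_cons_of_mem (Multiset.mem_cons_of_mem hc'), hs, hDc⟩

theorem VerifyInv.step_fake {c : Cell B N I State} {M S F J : Set (Trace B N I)}
    {τ : Trace B N I} (h : VerifyInv sem φe φf β c M S F J) (hτ : τ ∈ M)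
    (hf : Fake sem φe φf c.cond τ) : VerifyInv sem φe φf β c M S (insert τ F) J where
  __ := h
  subset := by
    have := h.subset
    simp only [Set.union_subset_iff, Set.insert_subset_iff] at this ⊢
    tauto
  fake := by
    rintro τ' (rfl | h')
    · exact hf
    · exact h.fake τ' h'

theorem VerifyInv.step_compatible {c : Cell B N I State} {M S F J : Set (Trace B N I)}
    {τ : Trace B N I} (h : VerifyInv sem φe φf β c M S F J) (hτ : τ ∈ M)
    (hc : (totalPre sem φe φf c.cond (insert τ S)).Nonempty) :
    VerifyInv sem φe φf β c M (insert τ S) F J where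
  __ := h
  subset := by
    have := h.subset
    simp only [Set.union_subset_iff, Set.insert_subset_iff] at this ⊢
    tauto
  compatible _ := hc
  -- Enlarging the mainstream only shrinks total preconditions, so earlier incompatibilities
  -- persist.
  incompatible τ' h' := Set.subset_eq_empty
    (totalPre_anti (Set.insert_subset_insert (Set.subset_insert τ S))) (h.incompatible τ' h')
  mainstream _ := Set.insert_nonempty τ S

theorem VerifyInv.step_incompatible {c : Cell B N I State} {M S F J : Set (Trace B N I)}
    {τ : Trace B N I} (h : VerifyInv sem φe φf β c M S F J) (hτ : τ ∈ M)
    (hf : ¬ Fake sem φe φf c.cond τ)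
    (hc : totalPre sem φe φf c.cond (insert τ S) = ∅) :
    VerifyInv sem φe φf β c M S F (insert τ J) where
  __ := h
  subset := by
    have := h.subset
    simp only [Set.union_subset_iff, Set.insert_subset_iff] at this ⊢
    tauto
  incompatible := by
    rintro τ' (rfl | h')
    · exact hc
    · exact h.incompatible τ' h'
  mainstream _ := by
    -- With an empty mainstream, incompatible would mean fake.
    by_contra hS
    rw [Set.not_nonempty_iff_eq_empty] at hS
    subst hS
    exact hf (by simpa [Fake] using hc)

theorem VerifyInv.isCounterexample {A : Set (Trace B N I)} {c : Cell B N I State}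
    {M S F J : Set (Trace B N I)} (h : VerifyInv sem φe φf β c M S F J) (hA : A.Finite)
    (hAP : A ⊆ P.language) (hc : c.traces ⊆ A) (hS : (β : ℝ≥0∞) < weight S) :
    S.Finite ∧ IsCounterexample sem P φe φf β S (totalPre sem φe φf c.cond S) := by
  have hSM : S ⊆ M := fun τ hτ => h.subset (.inl (.inl hτ))
  have hSA : S ⊆ A := hSM.trans (h.reason_subset.trans hc)
  exact ⟨hA.subset hSA, hSA.trans hAP, h.mergeable.pairwise.mono hSM,
    h.compatible (nonempty_of_lt_weight hS), fun _ hs => hs.1, fun _ hs => hs.2.2, hS⟩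

theorem ViolationWitness.inv_step (w : ViolationWitness sem P φe φf β s D)
    {c c' : Config B N I State} (h : c.Inv sem P φe φf β s D)
    (hstep : Step sem P φe φf β c c') : c'.Inv sem P φe φf β s D := by
  cases hstep with
  | sat_bound hb =>
    -- `D` is a mergeable subset of the uncertified traces, so the upper bound stays above `β`.
    exact absurd hb (not_le.2 (w.lt_upperBound (w.subset_remaining_union _ h.1.certified)))
  | sat_covered hR =>
    obtain ⟨τ, -, hτ⟩ := w.exists_mem_remaining h.1.certified h.2
    rw [hR] at hτ
    exact hτ
  | certify 𝒬 hp hv hτ hQ =>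
    refine ⟨⟨h.1.finite, h.1.subset, ?_⟩, h.2⟩
    rintro τ' ⟨𝒬', h', hτ'⟩
    rcases List.mem_cons.1 h' with rfl | h'
    · exact hQ τ' hτ'
    · exact h.1.certified τ' ⟨𝒬', h', hτ'⟩
  | @unsat_single Q A τ hp hv hw =>
    refine ⟨Set.finite_singleton τ, ?_, Set.pairwise_singleton _ _, hv, Set.inter_subset_left,
      ?_, ?_⟩
    · exact Set.singleton_subset_iff.2 hp.mem.1
    · rintro s hs τ' rfl
      exact hs.2
    · rwa [weight_singleton]
  | @store Q A τ hp hv hw =>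
    refine ⟨⟨h.1.finite.insert τ, Set.insert_subset hp.mem.1 h.1.subset, h.1.certified⟩,
      ⟨?_, fun hD => ?_⟩⟩
    · simp
    · exact ⟨_, Multiset.mem_singleton_self _, Set.mem_univ s, hD⟩
  | confirmed hb =>
    refine ⟨h.1, fun hD => ?_⟩
    -- Were `D` stored, its surviving cell alone would push the bound above `β`; so confirmation
    -- restores the main-loop invariant.
    obtain ⟨c, hc, -, hDc⟩ := h.2.survives hD
    exact absurd hb (not_le.2 ((w.lt_upperBound hDc).trans_le
      (le_iSup₂_of_le (f := fun (c : Cell B N I State) _ => upperBound c.traces) c hc le_rfl)))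
  | reason hb hM hm hw =>
    refine ⟨h.1, h.2, hM, hm, ?_, by simp, by simp, by simp, by simp, by simp⟩
    rw [hw]
    exact not_le.1 hb
  | fake hv hf => exact ⟨h.1, h.2.1, h.2.2.step_fake hv.mem.1 hf⟩
  | compatible hv hc => exact ⟨h.1, h.2.1, h.2.2.step_compatible hv.mem.1 hc⟩
  | incompatible hv hf hc => exact ⟨h.1, h.2.1, h.2.2.step_incompatible hv.mem.1 hf hc⟩
  | unsat_mainstream hS =>
    exact h.2.2.isCounterexample h.1.finite h.1.subset
      (h.2.1.subset _ (Multiset.mem_cons_self _ _)) hS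
  | erase hS hM hF hE => exact ⟨h.1, h.2.1.erase w hE⟩
  | split hS hM hJ hF hE hH =>
    subst hH
    exact ⟨h.1, h.2.1.split w h.2.2 hE⟩

/-! ### Termination: a lexicographic rank -/

/-- Traces of the program of length at most `L` in neither module. -/
def shortRemaining (P : PCFA (Label B N I)) (L : ℕ) (Q : List (PCFA (Label B N I)))
    (A : Set (Trace B N I)) : Set (Trace B N I) :=
  {τ ∈ remaining P Q A | τ.length ≤ L}

/-- Sets of traces of `A` that can violate together under a condition. -/
def jointlyViolating (sem : B → State → Option State) (φe φf : Set State)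
    (A : Set (Trace B N I)) (G : Set State) : Set (Set (Trace B N I)) :=
  {X | X ⊆ A ∧ (totalPre sem φe φf G X).Nonempty}

/-- Size of a cell: it decreases whenever the cell is replaced. -/
noncomputable def Cell.size (sem : B → State → Option State) (φe φf : Set State)
    (A : Set (Trace B N I)) (c : Cell B N I State) : ℕ :=
  c.traces.ncard + (jointlyViolating sem φe φf A c.cond).ncard

/-- Size of a split repository, which decreases in every round of the examination. -/
noncomputable def cellsSize (sem : B → State → Option State) (φe φf : Set State)
    (A : Set (Trace B N I)) (C : Multiset (Cell B N I State)) : ℕ :=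
  (C.map fun c => 3 ^ c.size sem φe φf A).sum

theorem finite_jointlyViolating {A : Set (Trace B N I)} (hA : A.Finite) (G : Set State) :
    (jointlyViolating sem φe φf A G).Finite :=
  hA.finite_subsets.subset fun _ h => h.1

theorem ncard_jointlyViolating_mono {A : Set (Trace B N I)} (hA : A.Finite) {G G' : Set State}
    (h : G ⊆ G') : (jointlyViolating sem φe φf A G).ncard ≤
      (jointlyViolating sem φe φf A G').ncard :=
  Set.ncard_le_ncard (fun X hX => ⟨hX.1, hX.2.mono (totalPre_mono_cond h X)⟩)
    (finite_jointlyViolating hA G')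

/-- `S` itself leaves the family: every state of `G` from which all of `S` violates has been
removed. -/
theorem ncard_jointlyViolating_diff_lt {A S : Set (Trace B N I)} (hA : A.Finite) {G : Set State}
    (hS : S ⊆ A) (hne : (totalPre sem φe φf G S).Nonempty) :
    (jointlyViolating sem φe φf A (G \ totalPre sem φe φf G S)).ncard <
      (jointlyViolating sem φe φf A G).ncard := by
  refine Set.ncard_lt_ncard ⟨fun X hX => ⟨hX.1, hX.2.mono (totalPre_mono_cond Set.sdiff_subset X)⟩,
    fun h => ?_⟩ (finite_jointlyViolating hA G)
  obtain ⟨t, ht⟩ := (h (⟨hS, hne⟩ : S ∈ jointlyViolating sem φe φf A G)).2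
  exact ht.2.1.2 ⟨ht.1, ht.2.1.1, ht.2.2⟩

theorem ncard_diff_lt {T E : Set (Trace B N I)} (hT : T.Finite) {τ : Trace B N I} (hτ : τ ∈ T)
    (hE : τ ∈ E) : (T \ E).ncard < T.ncard :=
  Set.ncard_lt_ncard ⟨Set.sdiff_subset, fun h => (h hτ).2 hE⟩ hT

theorem cellsSize_erase_lt {A E : Set (Trace B N I)} (hA : A.Finite) {c : Cell B N I State}
    {C : Multiset (Cell B N I State)} (hc : c.traces ⊆ A) {τ : Trace B N I} (hτ : τ ∈ c.traces)
    (hE : τ ∈ E) : cellsSize sem φe φf A (⟨c.cond, c.traces \ E⟩ ::ₘ C) <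
      cellsSize sem φe φf A (c ::ₘ C) := by
  simp only [cellsSize, Multiset.map_cons, Multiset.sum_cons]
  have := ncard_diff_lt (hA.subset hc) hτ hE
  gcongr
  · norm_num
  · simp only [Cell.size]
    omega

/-- The first new cell loses a trace. The second may keep all its traces, but `S` is no longer
jointly violating there; this is why the size also counts jointly violating sets. -/
theorem cellsSize_split_lt {A E₁ E₂ S : Set (Trace B N I)} (hA : A.Finite)
    {c : Cell B N I State} {C : Multiset (Cell B N I State)} (hc : c.traces ⊆ A)
    {τ : Trace B N I} (hτ : τ ∈ c.traces) (hE : τ ∈ E₁) (hS : S ⊆ A)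
    (hne : (totalPre sem φe φf c.cond S).Nonempty) :
    cellsSize sem φe φf A (⟨totalPre sem φe φf c.cond S, c.traces \ E₁⟩ ::ₘ
      ⟨c.cond \ totalPre sem φe φf c.cond S, c.traces \ E₂⟩ ::ₘ C) <
      cellsSize sem φe φf A (c ::ₘ C) := by
  simp only [cellsSize, Multiset.map_cons, Multiset.sum_cons]
  -- Base 3 absorbs the doubling: two smaller cells weigh at most two thirds of the old one.
  have hpow {m k : ℕ} (h : m < k) : 3 * 3 ^ m ≤ 3 ^ k := by
    rw [← pow_succ']
    exact Nat.pow_le_pow_right (by norm_num) h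
  have h₁ : Cell.size sem φe φf A ⟨totalPre sem φe φf c.cond S, c.traces \ E₁⟩ <
      c.size sem φe φf A := by
    have := ncard_diff_lt (hA.subset hc) hτ hE
    have : (jointlyViolating sem φe φf A (totalPre sem φe φf c.cond S)).ncard ≤
        (jointlyViolating sem φe φf A c.cond).ncard :=
      ncard_jointlyViolating_mono hA fun _ h => h.2.1
    simp only [Cell.size]
    omega
  have h₂ : Cell.size sem φe φf A
      ⟨c.cond \ totalPre sem φe φf c.cond S, c.traces \ E₂⟩ < c.size sem φe φf A := by
    have := ncard_jointlyViolating_diff_lt (sem := sem) (φe := φe) (φf := φf) hA hS hne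
    have : (c.traces \ E₂).ncard ≤ c.traces.ncard :=
      Set.ncard_le_ncard Set.sdiff_subset (hA.subset hc)
    simp only [Cell.size]
    omega
  have := hpow h₁
  have := hpow h₂
  have : 0 < 3 ^ c.size sem φe φf A := by positivity
  omega

/-- Termination rank, where `L` bounds the lengths of the traces of a witness. -/
noncomputable def Config.rank (sem : B → State → Option State) (P : PCFA (Label B N I))
    (φe φf : Set State) (L : ℕ) : Config B N I State → ℕ ×ₗ ℕ ×ₗ ℕ
  | .main Q A => toLex ((shortRemaining P L Q A).ncard + 1, toLex (0, 0))
  | .examine Q A C => toLex ((shortRemaining P L Q A).ncard + 1,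
      toLex (cellsSize sem φe φf A C + 1, A.ncard + 1))
  | .verify Q A C c M S F J => toLex ((shortRemaining P L Q A).ncard + 1,
      toLex (cellsSize sem φe φf A (c ::ₘ C) + 1, (M \ (S ∪ F ∪ J)).ncard))
  | .sat => toLex (0, toLex (0, 0))
  | .unsat _ _ => toLex (0, toLex (0, 0))

theorem finite_shortRemaining [Finite B] [Finite N] [Finite I] (L : ℕ)
    (Q : List (PCFA (Label B N I))) (A : Set (Trace B N I)) : (shortRemaining P L Q A).Finite :=
  (List.finite_length_le (Label B N I) L).subset fun _ h => h.2

theorem ncard_shortRemaining_lt [Finite B] [Finite N] [Finite I] {L : ℕ}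
    {Q Q' : List (PCFA (Label B N I))} {A A' : Set (Trace B N I)} {τ : Trace B N I}
    (hsub : remaining P Q' A' ⊆ remaining P Q A) (hτ : τ ∈ remaining P Q A)
    (hτ' : τ ∉ remaining P Q' A') (hL : τ.length ≤ L) :
    (shortRemaining P L Q' A').ncard < (shortRemaining P L Q A).ncard :=
  Set.ncard_lt_ncard ⟨fun _ h => ⟨hsub h.1, h.2⟩, fun h => hτ' (h ⟨hτ, hL⟩).1⟩
    (finite_shortRemaining L Q A)

/-- Picking shortest traces is essential here: a trace of `D` is still available, and it bounds the
length of the pick. -/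
theorem ViolationWitness.length_le_of_picks (w : ViolationWitness sem P φe φf β s D)
    {L : ℕ} (hL : ∀ τ ∈ D, τ.length ≤ L) {Q : List (PCFA (Label B N I))}
    {A : Set (Trace B N I)} (hQ : ∀ τ ∈ certified Q, ¬ Violating sem φe φf τ) (hD : ¬ D ⊆ A)
    {τ : Trace B N I} (hp : Picks P β Q A τ) : τ.length ≤ L := by
  obtain ⟨τ', hτ', hr⟩ := w.exists_mem_remaining hQ hD
  exact (hp.shortest τ' hr).trans (hL τ' hτ')

theorem VerifyInv.ncard_lt {A : Set (Trace B N I)} {c : Cell B N I State}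
    {M S F J X : Set (Trace B N I)} (h : VerifyInv sem φe φf β c M S F J) (hA : A.Finite)
    (hc : c.traces ⊆ A) {τ : Trace B N I} (hv : Verifies β M S F J τ)
    (hX : X = insert τ (S ∪ F ∪ J)) : (M \ X).ncard < (M \ (S ∪ F ∪ J)).ncard := by
  subst hX
  refine Set.ncard_lt_ncard ⟨Set.sdiff_subset_sdiff_right (Set.subset_insert _ _), fun hsub => ?_⟩
    ((hA.subset (h.reason_subset.trans hc)).sdiff)
  exact (hsub hv.mem).2 (Set.mem_insert _ _)

theorem ViolationWitness.rank_lt_of_step [Finite B] [Finite N] [Finite I]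
    (w : ViolationWitness sem P φe φf β s D) {L : ℕ} (hL : ∀ τ ∈ D, τ.length ≤ L)
    {c c' : Config B N I State} (h : c.Inv sem P φe φf β s D)
    (hstep : Step sem P φe φf β c c') :
    c'.rank sem P φe φf L < c.rank sem P φe φf L := by
  cases hstep with
  | sat_bound | sat_covered | unsat_single | unsat_mainstream =>
    exact Prod.Lex.toLex_lt_toLex.2 (.inl (Nat.succ_pos _))
  | @certify Q A τ 𝒬 hp hv hτ hQ =>
    refine Prod.Lex.toLex_lt_toLex.2 (.inl (Nat.succ_lt_succ (ncard_shortRemaining_lt ?_ hp.mem ?_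
      (w.length_le_of_picks hL h.1.certified h.2 hp))))
    · refine Set.sdiff_subset_sdiff_right (Set.union_subset_union_left _ ?_)
      rintro τ' ⟨𝒬', h', hτ'⟩
      exact ⟨𝒬', List.mem_cons_of_mem _ h', hτ'⟩
    · exact fun hr => hr.2 (.inl ⟨𝒬, List.mem_cons_self, hτ⟩)
  | @store Q A τ hp hv hw =>
    refine Prod.Lex.toLex_lt_toLex.2 (.inl (Nat.succ_lt_succ (ncard_shortRemaining_lt ?_ hp.mem ?_
      (w.length_le_of_picks hL h.1.certified h.2 hp))))
    · exact Set.sdiff_subset_sdiff_right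
        (Set.union_subset_union_right _ (Set.subset_insert _ _))
    · exact fun hr => hr.2 (.inr (Set.mem_insert _ _))
  | confirmed hb =>
    exact Prod.Lex.toLex_lt_toLex.2 (.inr ⟨rfl, Prod.Lex.toLex_lt_toLex.2
      (.inl (Nat.succ_pos _))⟩)
  | @reason Q A C c M hb hM hm hw =>
    refine Prod.Lex.toLex_lt_toLex.2 (.inr ⟨rfl, Prod.Lex.toLex_lt_toLex.2 (.inr ⟨rfl, ?_⟩)⟩)
    -- The last component before this step is `A.ncard + 1`, which exceeds the size of any `M ⊆ A`.
    have hMA : M ⊆ A := hM.trans (h.2.subset c (Multiset.mem_cons_self c C))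
    exact Nat.lt_succ_of_le (Set.ncard_le_ncard (Set.sdiff_subset.trans hMA) h.1.finite)
  | @fake Q A C c M S F J τ hv hf =>
    refine Prod.Lex.toLex_lt_toLex.2 (.inr ⟨rfl, Prod.Lex.toLex_lt_toLex.2 (.inr ⟨rfl, ?_⟩)⟩)
    refine h.2.2.ncard_lt h.1.finite (h.2.1.subset _ (Multiset.mem_cons_self _ _)) hv ?_
    simp only [Set.union_insert, Set.insert_union]
  | compatible hv hc =>
    refine Prod.Lex.toLex_lt_toLex.2 (.inr ⟨rfl, Prod.Lex.toLex_lt_toLex.2 (.inr ⟨rfl, ?_⟩)⟩)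
    refine h.2.2.ncard_lt h.1.finite (h.2.1.subset _ (Multiset.mem_cons_self _ _)) hv ?_
    simp only [Set.insert_union]
  | incompatible hv hf hc =>
    refine Prod.Lex.toLex_lt_toLex.2 (.inr ⟨rfl, Prod.Lex.toLex_lt_toLex.2 (.inr ⟨rfl, ?_⟩)⟩)
    refine h.2.2.ncard_lt h.1.finite (h.2.1.subset _ (Multiset.mem_cons_self _ _)) hv ?_
    simp only [Set.union_insert]
  | @erase Q A C c M S F E hS hM hF hE =>
    refine Prod.Lex.toLex_lt_toLex.2 (.inr ⟨rfl, Prod.Lex.toLex_lt_toLex.2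
      (.inl (Nat.succ_lt_succ ?_))⟩)
    -- Since `M` weighs more than `β`, a certificate needs at least one fake trace, so something is
    -- really erased.
    have hne : F.Nonempty := by
      by_contra hF
      rw [Set.not_nonempty_iff_eq_empty] at hF
      rw [hF, weight_empty, add_zero] at hM
      exact absurd hM (not_le.2 h.2.2.exceeds)
    obtain ⟨τ, hτ⟩ := hne
    exact cellsSize_erase_lt h.1.finite (h.2.1.subset _ (Multiset.mem_cons_self _ _))
      (h.2.2.reason_subset (h.2.2.subset (.inl (.inr hτ)))) (hF hτ)
  | @split Q A C c M S F J E H hS hM hJ hF hE hH =>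
    subst hH
    refine Prod.Lex.toLex_lt_toLex.2 (.inr ⟨rfl, Prod.Lex.toLex_lt_toLex.2
      (.inl (Nat.succ_lt_succ ?_))⟩)
    have hc := h.2.1.subset c (Multiset.mem_cons_self _ _)
    have hSA : S ⊆ A := fun τ hτ => hc (h.2.2.reason_subset (h.2.2.subset (.inl (.inl hτ))))
    -- An incompatible trace presupposes a nonempty mainstream, hence a satisfiable split condition.
    have hne := h.2.2.compatible (h.2.2.mainstream hJ)
    obtain ⟨τ, hτ⟩ := hJ
    exact cellsSize_split_lt h.1.finite hc
      (h.2.2.reason_subset (h.2.2.subset (.inr hτ))) (.inr hτ) hSA hne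

/-! ### Progress: only the answers are final -/

theorem exists_step_main [Finite B] [Finite N] [Finite I] (Q : List (PCFA (Label B N I)))
    (A : Set (Trace B N I)) : ∃ c' : Config B N I State, Step sem P φe φf β (.main Q A) c' := by
  by_cases hb : upperBound (remaining P Q A ∪ A) ≤ β
  · exact ⟨_, .sat_bound hb⟩
  rcases (remaining P Q A).eq_empty_or_nonempty with hR | hR
  · exact ⟨_, .sat_covered hR⟩
  obtain ⟨τ, hτ, hmin⟩ := exists_minimalFor_of_wellFoundedLT (· ∈ remaining P Q A) List.length hR
  have hp : Picks P β Q A τ := ⟨hb, hτ, fun τ' hτ' => (le_total _ _).elim id (hmin hτ')⟩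
  by_cases hv : Violating sem φe φf τ
  · rcases lt_or_ge (β : ℝ≥0∞) (wt τ) with hw | hw
    · exact ⟨_, .unsat_single hp hv hw⟩
    · exact ⟨_, .store hp hv hw⟩
  -- The trivial generalisation, an automaton accepting `τ` alone, is always available.
  · obtain ⟨𝒬, -, h𝒬⟩ := mergeable_of_finite (Set.finite_singleton τ)
      (Set.pairwise_singleton τ BranchAtProb)
    refine ⟨_, .certify 𝒬 hp hv ?_ ?_⟩
    · simp [h𝒬]
    · simpa [h𝒬] using hv

theorem exists_weight_eq_upperBound [Finite B] [Finite N] [Finite I] {T : Set (Trace B N I)}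
    (hT : T.Finite) : ∃ M ⊆ T, Mergeable M ∧ weight M = upperBound T := by
  have hfin : {Ξ | Ξ ⊆ T ∧ Mergeable Ξ}.Finite := hT.finite_subsets.subset fun _ h => h.1
  have hne : {Ξ | Ξ ⊆ T ∧ Mergeable Ξ}.Nonempty :=
    ⟨∅, Set.empty_subset T, mergeable_of_finite Set.finite_empty (Set.pairwise_empty _)⟩
  obtain ⟨M, hM, hmax⟩ := Set.exists_max_image _ weight hfin hne
  exact ⟨M, hM.1, hM.2, le_antisymm (le_iSup₂_of_le M hM le_rfl) (iSup₂_le hmax)⟩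

/-- A finite supremum is attained unless there are no cells; that case has value zero and is
excluded by `hC`. -/
theorem exists_upperBound_eq_splitUpperBound {C : Multiset (Cell B N I State)}
    (hC : splitUpperBound C ≠ 0) : ∃ c ∈ C, upperBound c.traces = splitUpperBound C := by
  classical
  have hne : {c | c ∈ C}.Nonempty := by
    by_contra h
    rw [Set.not_nonempty_iff_eq_empty] at h
    refine hC (le_antisymm (iSup₂_le fun c hc => ?_) (zero_le))
    exact absurd hc (Set.eq_empty_iff_forall_notMem.1 h c)
  have hfin : {c | c ∈ C}.Finite := C.toFinset.finite_toSet.subset fun c hc => by simpa using hc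
  obtain ⟨c, hc, hmax⟩ := Set.exists_max_image _ (fun c => upperBound c.traces) hfin hne
  exact ⟨c, hc, le_antisymm
    (le_iSup₂_of_le (f := fun (c : Cell B N I State) _ => upperBound c.traces) c hc le_rfl)
    (iSup₂_le hmax)⟩

theorem exists_step_examine [Finite B] [Finite N] [Finite I] (Q : List (PCFA (Label B N I)))
    {A : Set (Trace B N I)} (hA : A.Finite) {C : Multiset (Cell B N I State)}
    (hC : ∀ c ∈ C, c.traces ⊆ A) :
    ∃ c' : Config B N I State, Step sem P φe φf β (.examine Q A C) c' := by
  by_cases hb : splitUpperBound C ≤ β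
  · exact ⟨_, .confirmed hb⟩
  obtain ⟨c, hc, hmax⟩ := exists_upperBound_eq_splitUpperBound (C := C)
    fun h => hb (h ▸ zero_le)
  obtain ⟨C', rfl⟩ := Multiset.exists_cons_of_mem hc
  obtain ⟨M, hM, hm, hw⟩ := exists_weight_eq_upperBound (hA.subset (hC c hc))
  exact ⟨_, .reason hb hM hm (hw.trans hmax)⟩

theorem VerifyInv.exists_step (Q : List (PCFA (Label B N I))) {A : Set (Trace B N I)}
    (hA : A.Finite) {c : Cell B N I State} (C : Multiset (Cell B N I State)) (hc : c.traces ⊆ A)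
    {M S F J : Set (Trace B N I)} (h : VerifyInv sem φe φf β c M S F J) :
    ∃ c' : Config B N I State, Step sem P φe φf β (.verify Q A C c M S F J) c' := by
  by_cases hS : (β : ℝ≥0∞) < weight S
  · exact ⟨_, .unsat_mainstream hS⟩
  by_cases hM : weight M ≤ β + weight (F ∪ J)
  · rcases J.eq_empty_or_nonempty with rfl | hJ
    · exact ⟨_, .erase hS (by simpa using hM) subset_rfl h.fake⟩
    · exact ⟨_, .split hS hM hJ subset_rfl h.fake rfl⟩
  -- If `M` were exhausted while `S` weighs at most `β`, then `F ∪ J` would make up the rest of its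
  -- weight, and the stopping criterion would already hold.
  have hne : (M \ (S ∪ F ∪ J)).Nonempty := by
    by_contra he
    rw [Set.not_nonempty_iff_eq_empty, Set.sdiff_eq_empty] at he
    have he : M = S ∪ (F ∪ J) := by
      rw [← Set.union_assoc]
      exact he.antisymm h.subset
    refine hM ?_
    calc weight M = weight (S ∪ (F ∪ J)) := by rw [← he]
      _ ≤ weight S + weight (F ∪ J) := weight_union_le _ _
      _ ≤ β + weight (F ∪ J) := by gcongr; exact not_lt.1 hS
  obtain ⟨τ, hτ, hmax⟩ := Set.exists_max_image _ wt
    (hA.subset (h.reason_subset.trans hc)).sdiff hne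
  have hv : Verifies β M S F J τ := ⟨hS, hM, hτ, hmax⟩
  by_cases hf : Fake sem φe φf c.cond τ
  · exact ⟨_, .fake hv hf⟩
  rcases (totalPre sem φe φf c.cond (insert τ S)).eq_empty_or_nonempty with hi | hi
  · exact ⟨_, .incompatible hv hf hi⟩
  · exact ⟨_, .compatible hv hi⟩

end Algorithm

end ProbTA

/-! ### Termination with a counterexample -/

theorem mainTheorem5 {B N I : Type*} [Finite B] [Finite N] [Finite I] {State : Type*}
    (sem : B → State → Option State) (P : ProbTA.PCFA (ProbTA.Label B N I)) (hP : P.IsCFMDP)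
    (φe φf : Set State) (β : ℝ≥0) (hviol : ¬ ProbTA.Satisfies sem P φe φf β) :
    (¬ ∃ r : ℕ → ProbTA.Config B N I State, r 0 = ProbTA.Config.initial ∧
        ∀ n, ProbTA.Step sem P φe φf β (r n) (r (n + 1))) ∧
    (∀ c : ProbTA.Config B N I State,
      Relation.ReflTransGen (ProbTA.Step sem P φe φf β) ProbTA.Config.initial c →
      (∀ c', ¬ ProbTA.Step sem P φe φf β c c') →
      ∃ S φerr, c = ProbTA.Config.unsat S φerr ∧ S.Finite ∧
        ProbTA.IsCounterexample sem P φe φf β S φerr) := by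
  obtain ⟨s, D, w⟩ := ProbTA.exists_violationWitness hP hviol
  have hreach : ∀ c : ProbTA.Config B N I State,
      Relation.ReflTransGen (ProbTA.Step sem P φe φf β) ProbTA.Config.initial c →
      c.Inv sem P φe φf β s D := by
    intro c hc
    induction hc with
    | refl => exact w.inv_initial
    | tail _ hstep ih => exact w.inv_step ih hstep
  constructor
  · rintro ⟨r, hr, hstep⟩
    obtain ⟨L, hL⟩ := (w.finite.image List.length).bddAbove
    have hinv (n : ℕ) : (r n).Inv sem P φe φf β s D := by
      induction n with
      | zero => exact hr ▸ w.inv_initial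
      | succ n ih => exact w.inv_step ih (hstep n)
    -- An infinite run would give an infinite descent of ranks in a well-founded order.
    exact (RelEmbedding.natGT (fun n => (r n).rank sem P φe φf L) fun n =>
      w.rank_lt_of_step (fun τ hτ => hL ⟨τ, hτ, rfl⟩) (hinv n) (hstep n)).not_wellFounded
      wellFounded_lt
  · intro c hc hstuck
    have hinv := hreach c hc
    have hno : ¬ ∃ c', ProbTA.Step sem P φe φf β c c' := fun ⟨c', h⟩ => hstuck c' h
    cases c with
    | main Q A => exact absurd (ProbTA.exists_step_main Q A) hno
    | examine Q A C =>
      exact absurd (ProbTA.exists_step_examine Q hinv.1.finite hinv.2.subset) hno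
    | verify Q A C c M S F J =>
      exact absurd (hinv.2.2.exists_step Q hinv.1.finite C
        (hinv.2.1.subset c (Multiset.mem_cons_self c C))) hno
    | sat => exact hinv.elim
    | unsat S φerr => exact ⟨S, φerr, rfl, hinv⟩
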